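/- Let $G_0$ be a finite connected graph (loops and multiple edges are allowed; a loop adds $2$ to the degree) with $\tau_0\ge 2$ vertices, one of which is designated as the hook. Let $d_1<\dots<d_k$ be the distinct degrees of the vertices of $G_0$, let $n_j\ge 1$ be the number of vertices of $G_0$ of degree $d_j$, and let $h=d_i$ be the degree of the hook. In the unary hooking network grown from the seed $G_0$, each node has one insertion position, which is used up when the node serves as a latch. The network at age $0$ is $G_0$. At each step $n\ge1$, one of the insertion positions of the network at age $n-1$ is chosen uniformly at random, independently of the past given the network, and the hook of a new copy of $G_0$ is fused with the node (the latch) that carries this position; the fused node has no insertion position left, and every other node of the new copy has one. Let $\mathbf A$ be the $k\times k$ matrix with entries $a_{j,\ell}=n_\ell-\mathbf 1[\ell=i]-\mathbf 1[\ell=j]$ (the replacement matrix of the associated Pólya urn, in which the balls of color $j$ are the insertion positions at nodes originally of degree $d_j$). Call the network nondegenerate if no component of the principal eigenvector of $\mathbf A^T$ (an eigenvector for the eigenvalue with the largest real part) is $0$. For $j\in\{1,\dots,k\}$ and $s\in\{0,1\}$, let $D_{n,d_j+sh}$ be the number of nodes in the network at age $n$ that are originally (when they appear) of degree $d_j$ and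 have been latches $s$ times; counts with different $(j,s)$ are kept separate even if the numbers $d_j+sh$ coincide. If the network is nondegenerate, then, almost surely, as $n\to\infty$, $$\frac1n\big(D_{n,d_1},\dots,D_{n,d_k},D_{n,d_1+h},\dots,D_{n,d_k+h}\big)\longrightarrow \frac1{\tau_0-1}\big((\tau_0-2)\,\mathbf n',\ \mathbf n'\big),\qquad \mathbf n'=(n_1,\dots,n_{i-1},n_i-1,n_{i+1},\dots,n_k).$$ -/

import Mathlib

open Filter Topology MeasureTheory
open scoped Graph

noncomputable section

namespace HookingNetwork

variable {V E : Type*}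

/-- The degree of a vertex in a multigraph: a loop contributes two, any other edge at the vertex
contributes one. -/
def degree {α β : Type*} (G : Graph α β) (x : α) : ℕ :=
  (G.incidenceSet x).ncard + (G.loopSet x).ncard

/-- A multigraph is connected if it has a vertex and any two of its vertices are joined by a
path. -/
def Connected {α β : Type*} (G : Graph α β) : Prop :=
  V(G).Nonempty ∧ ∀ x ∈ V(G), ∀ y ∈ V(G), Relation.ReflTransGen G.Adj x y

open Classical in
/-- Where a vertex of the seed goes when a copy of the seed is hooked. The seed itself is copy `0`,
and its vertex `v` is the node `(0, v)`. In copy `t + 1`, the hook is fused with the latch `q t`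
chosen at step `t + 1`, and any other vertex `v` becomes a new node `(t + 1, v)`. -/
def place (hook : V) (q : ℕ → ℕ × V) : ℕ → V → ℕ × V
  | 0, v => (0, v)
  | t + 1, v => if v = hook then q t else (t + 1, v)

/-- The network at age `n` grown from the seed `S` when the latches `q 0, q 1, …, q (n - 1)` are
chosen at the steps `1, 2, …, n`: the union of the copies `0, …, n` of the seed, in which the hook
of each copy `t + 1` is fused with `q t`. The edge `e` of copy `t` is labelled `(t, e)`. -/
def network (S : Graph V E) (hook : V) (q : ℕ → ℕ × V) (n : ℕ) : Graph (ℕ × V) (ℕ × E) where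
  vertexSet := {x | ∃ t ≤ n, ∃ v ∈ V(S), x = place hook q t v}
  IsLink e x y := e.1 ≤ n ∧ ∃ u v, S.IsLink e.2 u v ∧
    x = place hook q e.1 u ∧ y = place hook q e.1 v
  isLink_symm := by
    intro e _
    constructor
    rintro x y ⟨hn, u, v, h, hx, hy⟩
    exact ⟨hn, v, u, h.symm, hy, hx⟩
  eq_or_eq_of_isLink_of_isLink := by
    rintro e x y z w ⟨_, u, v, h, rfl, rfl⟩ ⟨_, u', v', h', rfl, rfl⟩
    rcases h.left_eq_or_eq h' with rfl | rfl
    · exact Or.inl rfl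
    · exact Or.inr rfl
  left_mem_of_isLink := by
    rintro e x y ⟨hn, u, v, h, rfl, rfl⟩
    exact ⟨e.1, hn, u, h.left_mem, rfl⟩

/-- The number of times that the node `x` has been the latch by age `n`. -/
def latchCount (q : ℕ → ℕ × V) (n : ℕ) (x : ℕ × V) : ℕ :=
  {t : ℕ | t < n ∧ q t = x}.ncard

/-- The insertion positions (virtual nodes) of the `m`-ary network at age `n`: a node that has
recruited `r` times carries `m - r` of them. A position is written as `(x, c)`, where `x` is the
node to which it is attached and `c` is its index at that node. -/
def insertionPositions (S : Graph V E) (hook : V) (m : ℕ) (q : ℕ → ℕ × V) (n : ℕ) :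
    Set ((ℕ × V) × ℕ) :=
  {p | p.1 ∈ V(network S hook q n) ∧ p.2 < m - latchCount q n p.1}

/-- The random latches `L 0, L 1, …`, defined on a probability space, grow an `m`-ary hooking network
under the uniform model: given the choices at the steps `1, …, n`, one of the insertion positions
of the network at age `n` is chosen, all of them being equally likely, and `L n` is the node to
which the chosen position is attached. -/
structure IsUniformHooking (S : Graph V E) (hook : V) (m : ℕ) {Ω : Type*} [MeasurableSpace Ω]
    (P : Measure Ω) (L : ℕ → Ω → ℕ × V) : Prop where
  measurable : ∀ n x, MeasurableSet {ω | L n ω = x}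
  uniform : ∀ (n : ℕ) (q : ℕ → ℕ × V) (x : ℕ × V),
    P {ω | ∀ t < n, L t ω = q t} ≠ 0 →
      ProbabilityTheory.cond P {ω | ∀ t < n, L t ω = q t} {ω | L n ω = x} =
        ({p ∈ insertionPositions S hook m q n | p.1 = x}.ncard : ENNReal) /
          ((insertionPositions S hook m q n).ncard : ENNReal)

/-- The original degree of a node `x = (t, v)`: its degree in the network at age `t`, at which the
node appears. -/
def originalDegree (S : Graph V E) (hook : V) (q : ℕ → ℕ × V) (x : ℕ × V) : ℕ :=
  degree (network S hook q x.1) x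

/-- The number of nodes in the network at age `n` that are originally of degree `δ` and have
experienced latching `s` times. -/
def nodeCount (S : Graph V E) (hook : V) (q : ℕ → ℕ × V) (n δ s : ℕ) : ℕ :=
  {x ∈ V(network S hook q n) | originalDegree S hook q x = δ ∧ latchCount q n x = s}.ncard

/-- The number of vertices of degree `δ` in the seed. -/
def seedCount (S : Graph V E) (δ : ℕ) : ℕ :=
  {v ∈ V(S) | degree S v = δ}.ncard

/-- The replacement matrix of the Pólya urn of the insertion positions of an `m`-ary network, for a
seed with `N j` vertices of the `j`-th degree and a hook of the `i`-th degree. The colour `(s, j)` is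
that of the positions at nodes originally of the `j`-th degree which have recruited `s` times.
When a position of colour `(s, j)` is drawn, the hooked copy brings `m` positions of colour `(0, l)`
for each of its vertices of the `l`-th degree other than the hook, and the `m - s` positions of
colour `(s, j)` at the latch are replaced by `m - s - 1` positions of colour `(s + 1, j)`. -/
def replacementMatrix (m : ℕ) {k : ℕ} (N : Fin k → ℕ) (i : Fin k) :
    Matrix (Fin m × Fin k) (Fin m × Fin k) ℤ :=
  Matrix.of fun a b =>
    (if (b.1 : ℕ) = 0 then (m : ℤ) * ((N b.2 : ℤ) - if b.2 = i then 1 else 0) else 0)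
      - (if b = a then (m : ℤ) - (a.1 : ℕ) else 0)
      + (if (b.1 : ℕ) = (a.1 : ℕ) + 1 ∧ b.2 = a.2 then (m : ℤ) - (a.1 : ℕ) - 1 else 0)

/-- `v` is a principal eigenvector of the complex matrix `M`: an eigenvector for an eigenvalue with
the largest real part, scaled so that `‖v‖₁ = 1`. -/
def IsPrincipalEigenvector {ι : Type*} [Fintype ι] [DecidableEq ι] (M : Matrix ι ι ℂ)
    (v : ι → ℂ) : Prop :=
  ∑ c, ‖v c‖ = 1 ∧
    ∃ μ : ℂ, M.mulVec v = μ • v ∧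
      ∀ ν : ℂ, Module.End.HasEigenvalue (Matrix.toLin' M) ν → ν.re ≤ μ.re

/-- The network is nondegenerate if no component of the principal eigenvector of the transposed
replacement matrix vanishes. -/
def Nondegenerate (m : ℕ) {k : ℕ} (N : Fin k → ℕ) (i : Fin k) : Prop :=
  ∀ v : Fin m × Fin k → ℂ,
    IsPrincipalEigenvector ((replacementMatrix m N i).map (Int.cast : ℤ → ℂ)).transpose v →
      ∀ c, v c ≠ 0

end HookingNetwork

end

noncomputable section

namespace HookingNetwork

/-! The urn is handled by second moments rather than by spectral theory. With one insertion position
per node, the latches are distinct, so the nodes of a given original degree split into free nodes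
and past latches. Their total is deterministic, so it is enough to count the latches. Let `τ` be the
number of seed vertices, `B` the number of non-hook vertices with property `p`, and `b = B / (τ -
1)`. At age `n` there are `T = τ + n(τ - 2)` free nodes, of which `Y` have property `p`. One step
changes `Y` by `B` minus the indicator that the latch has `p`, an event of conditional probability
`Y / T`. Hence `w = Y - bT` (`deviation`) has conditional mean `w(1 - 1/T)` after the step and
conditional variance at most `1`, so `E w² ≤ w₀² + n` (`lintegral_history_le`,
`lintegral_deviation_sq_le`). Along `n = k²` the second moments of `w / n` are summable, and bounded
increments fill the gaps, so `w = o(n)` almost surely (`ae_tendsto_div_of_lintegral_sq_le`). Solving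
for the latch tally gives the limit `b` for nodes that have been latches, and `B - b = b(τ - 2)` for
free ones. -/

/-- The nodes of the network at age `n`, provided that every latch is a node of the network from
which it is chosen. -/
def nodes {V E : Type*} (S : Graph V E) (hook : V) (n : ℕ) : Set (ℕ × V) :=
  {x | x.1 ≤ n ∧ x.2 ∈ V(S) ∧ (x.1 = 0 ∨ x.2 ≠ hook)}

/-- The first `n` latches are distinct, and each is a node of the network from which it is
chosen. -/
def IsLatchSeq {V E : Type*} (S : Graph V E) (hook : V) (q : ℕ → ℕ × V) (n : ℕ) : Prop :=
  ∀ t < n, q t ∈ nodes S hook t ∧ ∀ s < t, q s ≠ q t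

open Classical in
/-- The number of the first `n` latches at vertices with the property `p`. -/
def latchTally {V : Type*} (p : V → Prop) (q : ℕ → ℕ × V) (n : ℕ) : ℕ :=
  ((Finset.range n).filter fun t => p (q t).2).card

/-- The nodes at age `n` at vertices with the property `p` which have not been latches. -/
def freeNodes {V E : Type*} (S : Graph V E) (hook : V) (p : V → Prop) (q : ℕ → ℕ × V) (n : ℕ) :
    Set (ℕ × V) :=
  {x | x ∈ nodes S hook n ∧ p x.2 ∧ ∀ t < n, q t ≠ x}

/-! ### Deterministic counts of nodes, latches and insertion positions. -/

section Combinatorics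

variable {V E : Type*} {S : Graph V E} {hook : V} {q : ℕ → ℕ × V} {n : ℕ}

theorem nodes_finite [Finite V] (n : ℕ) : (nodes S hook n).Finite :=
  ((Set.finite_Iic n).prod (Set.finite_univ (α := V))).subset fun _ hx => ⟨hx.1, trivial⟩

theorem place_mem_nodes (h : IsLatchSeq S hook q n) {t : ℕ} (ht : t ≤ n)
    {v : V} (hv : v ∈ V(S)) : place hook q t v ∈ nodes S hook n := by
  rcases t with _ | t
  · exact ⟨Nat.zero_le _, hv, Or.inl rfl⟩
  · by_cases hvh : v = hook
    · have := (h t ht).1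
      simp only [place, hvh, if_true]
      exact ⟨this.1.trans (by omega), this.2⟩
    · simp only [place, hvh, if_false]
      exact ⟨ht, hv, Or.inr hvh⟩

theorem place_eq_of_mem_nodes {x : ℕ × V} (hx : x ∈ nodes S hook n) :
    place hook q x.1 x.2 = x := by
  obtain ⟨t, v⟩ := x
  rcases t with _ | t
  · rfl
  · have : v ≠ hook := by simpa using hx.2.2
    simp [place, this]

theorem vertexSet_network (h : IsLatchSeq S hook q n) :
    V(network S hook q n) = nodes S hook n := by
  ext x
  constructor
  · rintro ⟨t, ht, v, hv, rfl⟩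
    exact place_mem_nodes h ht hv
  · intro hx
    exact ⟨x.1, hx.1, x.2, hx.2.1, (place_eq_of_mem_nodes hx).symm⟩

/-- The hook of copy `s + 1` lands on a node of age at most `s`, hence older than `x`. So up to the
age at which `x` appears, only its own copy reaches it. -/
theorem place_eq_iff {x : ℕ × V} (hx : x ∈ nodes S hook n) (h : IsLatchSeq S hook q n)
    {s : ℕ} (hs : s ≤ x.1) {u : V} : place hook q s u = x ↔ s = x.1 ∧ u = x.2 := by
  constructor
  · intro hp
    rcases s with _ | s
    · rw [← hp]
      exact ⟨rfl, rfl⟩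
    · by_cases hu : u = hook
      · simp only [place, hu, if_true] at hp
        have h1 := (h s (by have := hx.1; omega)).1.1
        rw [hp] at h1
        omega
      · simp only [place, hu, if_false] at hp
        rw [← hp]
        exact ⟨rfl, rfl⟩
  · rintro ⟨rfl, rfl⟩
    exact place_eq_of_mem_nodes hx

/-- By `place_eq_iff`, the edges and loops at `x` when it appears all come from its own copy, which
makes the original degree a property of the seed vertex `x.2` alone. -/
theorem originalDegree_eq {x : ℕ × V} (hx : x ∈ nodes S hook n) (h : IsLatchSeq S hook q n) :
    originalDegree S hook q x = degree S x.2 := by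
  have h1 : (network S hook q x.1).incidenceSet x = Prod.mk x.1 '' S.incidenceSet x.2 := by
    ext ⟨s, f⟩
    constructor
    · rintro ⟨y, hs, u, v, huv, hu, hv⟩
      obtain ⟨h1, rfl⟩ := (place_eq_iff hx h hs).1 hu.symm
      exact ⟨f, ⟨v, huv⟩, by rw [← h1]⟩
    · rintro ⟨f', ⟨v, hv⟩, heq⟩
      obtain ⟨rfl, rfl⟩ := Prod.mk.inj heq
      exact ⟨_, le_rfl, x.2, v, hv, (place_eq_of_mem_nodes hx).symm, rfl⟩
  have h2 : (network S hook q x.1).loopSet x = Prod.mk x.1 '' S.loopSet x.2 := by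
    ext ⟨s, f⟩
    constructor
    · rintro ⟨hs, u, v, huv, hu, hv⟩
      obtain ⟨h1, rfl⟩ := (place_eq_iff hx h hs).1 hu.symm
      obtain ⟨-, rfl⟩ := (place_eq_iff hx h hs).1 hv.symm
      exact ⟨f, huv, by rw [← h1]⟩
    · rintro ⟨f', hv, heq⟩
      obtain ⟨rfl, rfl⟩ := Prod.mk.inj heq
      exact ⟨le_rfl, x.2, x.2, hv, (place_eq_of_mem_nodes hx).symm,
        (place_eq_of_mem_nodes hx).symm⟩
  rw [originalDegree, degree, degree, h1, h2, (Prod.mk_right_injective _).injOn.ncard_image,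
    (Prod.mk_right_injective _).injOn.ncard_image]

theorem ncard_nodes [Finite V] (p : V → Prop) (n : ℕ) :
    {x ∈ nodes S hook n | p x.2}.ncard =
      {v ∈ V(S) | p v}.ncard + n * {v ∈ V(S) | v ≠ hook ∧ p v}.ncard := by
  induction n with
  | zero =>
    have : {x ∈ nodes S hook 0 | p x.2} = Prod.mk 0 '' {v ∈ V(S) | p v} := by
      ext ⟨t, v⟩
      simp only [nodes, Set.mem_ofPred_eq, Set.mem_image, Prod.mk.injEq]
      constructor
      · rintro ⟨⟨h1, h2, -⟩, h3⟩
        exact ⟨v, ⟨h2, h3⟩, by omega, rfl⟩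
      · rintro ⟨v, ⟨h2, h3⟩, rfl, rfl⟩
        exact ⟨⟨le_rfl, h2, Or.inl rfl⟩, h3⟩
    rw [this, (Prod.mk_right_injective _).injOn.ncard_image]
    simp
  | succ n ih =>
    have : {x ∈ nodes S hook (n + 1) | p x.2} = {x ∈ nodes S hook n | p x.2} ∪
        Prod.mk (n + 1) '' {v ∈ V(S) | v ≠ hook ∧ p v} := by
      ext ⟨t, v⟩
      simp only [nodes, Set.mem_ofPred_eq, Set.mem_image, Prod.mk.injEq, Set.mem_union]
      constructor
      · rintro ⟨⟨h1, h2, h3⟩, h4⟩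
        rcases Nat.le_succ_iff.1 h1 with h | h
        · exact Or.inl ⟨⟨h, h2, h3⟩, h4⟩
        · exact Or.inr ⟨v, ⟨h2, h3.resolve_left (by omega), h4⟩, h.symm, rfl⟩
      · rintro (⟨⟨h1, h2, h3⟩, h4⟩ | ⟨v, ⟨h2, h3, h4⟩, rfl, rfl⟩)
        · exact ⟨⟨by omega, h2, h3⟩, h4⟩
        · exact ⟨⟨le_rfl, h2, Or.inr h3⟩, h4⟩
    have hdisj : Disjoint {x ∈ nodes S hook n | p x.2}
        (Prod.mk (n + 1) '' {v ∈ V(S) | v ≠ hook ∧ p v}) := by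
      rw [Set.disjoint_left]
      rintro _ ⟨⟨h1, -⟩, -⟩ ⟨v, -, rfl⟩
      simp at h1
    rw [this, Set.ncard_union_eq hdisj ((nodes_finite n).subset (Set.sep_subset _ _)), ih,
      (Prod.mk_right_injective _).injOn.ncard_image]
    ring

theorem ncard_latched (p : V → Prop) (h : IsLatchSeq S hook q n) :
    {x | x ∈ nodes S hook n ∧ p x.2 ∧ ∃ t < n, q t = x}.ncard = latchTally p q n := by
  classical
  have : {x | x ∈ nodes S hook n ∧ p x.2 ∧ ∃ t < n, q t = x} =
      q '' ((Finset.range n).filter fun t => p (q t).2) := by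
    ext x
    simp only [Set.mem_ofPred_eq, Set.mem_image, Finset.coe_filter, Finset.mem_range]
    constructor
    · rintro ⟨-, hp, t, ht, rfl⟩
      exact ⟨t, ⟨ht, hp⟩, rfl⟩
    · rintro ⟨t, ⟨ht, hp⟩, rfl⟩
      have := (h t ht).1
      exact ⟨⟨this.1.trans ht.le, this.2⟩, hp, t, ht, rfl⟩
  rw [this, Set.InjOn.ncard_image, Set.ncard_coe_finset, latchTally]
  intro s hs t ht hst
  simp only [Finset.coe_filter, Finset.mem_range, Set.mem_ofPred_eq] at hs ht
  rcases lt_trichotomy s t with hlt | rfl | hlt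
  · exact absurd hst ((h t ht.1).2 s hlt)
  · rfl
  · exact absurd hst.symm ((h s hs.1).2 t hlt)

/-- The conservation law that reduces both kinds of node count to the single random quantity
`latchTally`. -/
theorem ncard_freeNodes_add_latchTally [Finite V] (p : V → Prop) (h : IsLatchSeq S hook q n) :
    (freeNodes S hook p q n).ncard + latchTally p q n =
      {v ∈ V(S) | p v}.ncard + n * {v ∈ V(S) | v ≠ hook ∧ p v}.ncard := by
  rw [← ncard_nodes, ← ncard_latched p h]
  have hU : {x ∈ nodes S hook n | p x.2} = freeNodes S hook p q n ∪
      {x | x ∈ nodes S hook n ∧ p x.2 ∧ ∃ t < n, q t = x} := by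
    ext x
    simp only [freeNodes, Set.mem_ofPred_eq, Set.mem_union]
    by_cases hx : ∃ t < n, q t = x
    · have : ¬ ∀ t < n, q t ≠ x := by push Not; exact hx
      tauto
    · have : ∀ t < n, q t ≠ x := by push Not at hx; exact hx
      tauto
  rw [hU, Set.ncard_union_eq _ ((nodes_finite n).subset fun _ hx => hx.1)
    ((nodes_finite n).subset fun _ hx => hx.1)]
  rw [Set.disjoint_left]
  rintro x ⟨-, -, h1⟩ ⟨-, -, t, ht, h2⟩
  exact h1 t ht h2

theorem latchCount_of_free {x : ℕ × V} (hx : ∀ t < n, q t ≠ x) : latchCount q n x = 0 := by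
  have : {t : ℕ | t < n ∧ q t = x} = ∅ := by
    ext t
    simpa using hx t
  rw [latchCount, this, Set.ncard_empty]

theorem latchCount_of_latched (h : IsLatchSeq S hook q n) {t : ℕ} (ht : t < n) :
    latchCount q n (q t) = 1 := by
  have : {s : ℕ | s < n ∧ q s = q t} = {t} := by
    ext s
    simp only [Set.mem_ofPred_eq, Set.mem_singleton_iff]
    constructor
    · rintro ⟨hs, hst⟩
      rcases lt_trichotomy s t with hlt | rfl | hlt
      · exact absurd hst ((h t ht).2 s hlt)
      · rfl
      · exact absurd hst.symm ((h s hs).2 t hlt)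
    · rintro rfl
      exact ⟨ht, rfl⟩
  rw [latchCount, this, Set.ncard_singleton]

theorem latchCount_eq_zero_iff (h : IsLatchSeq S hook q n) (x : ℕ × V) :
    latchCount q n x = 0 ↔ ∀ t < n, q t ≠ x := by
  refine ⟨?_, latchCount_of_free⟩
  rintro hx t ht rfl
  simp [latchCount_of_latched h ht] at hx

theorem latchCount_eq_one_iff (h : IsLatchSeq S hook q n) (x : ℕ × V) :
    latchCount q n x = 1 ↔ ∃ t < n, q t = x := by
  constructor
  · intro hx
    by_contra! hc
    simp [latchCount_of_free hc] at hx
  · rintro ⟨t, ht, rfl⟩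
    exact latchCount_of_latched h ht

theorem insertionPositions_eq (h : IsLatchSeq S hook q n) :
    insertionPositions S hook 1 q n =
      (fun x => (x, 0)) '' freeNodes S hook (fun _ => True) q n := by
  ext ⟨x, c⟩
  simp only [insertionPositions, freeNodes, vertexSet_network h, Set.mem_ofPred_eq,
    Set.mem_image, Prod.mk.injEq, true_and, ← latchCount_eq_zero_iff h]
  constructor
  · rintro ⟨h1, h2⟩
    exact ⟨x, ⟨h1, by omega⟩, rfl, by omega⟩
  · rintro ⟨y, ⟨h1, h2⟩, rfl, rfl⟩
    exact ⟨h1, by omega⟩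

theorem ncard_insertionPositions (h : IsLatchSeq S hook q n) :
    (insertionPositions S hook 1 q n).ncard = (freeNodes S hook (fun _ => True) q n).ncard := by
  rw [insertionPositions_eq h, Set.InjOn.ncard_image]
  exact (Prod.mk_left_injective 0).injOn

theorem ncard_insertionPositions_at_of_mem (h : IsLatchSeq S hook q n)
    {x : ℕ × V} (hx : x ∈ freeNodes S hook (fun _ => True) q n) :
    {p ∈ insertionPositions S hook 1 q n | p.1 = x}.ncard = 1 := by
  rw [Set.ncard_eq_one]
  refine ⟨(x, 0), ?_⟩
  ext ⟨y, c⟩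
  simp only [insertionPositions_eq h, Set.mem_ofPred_eq, Set.mem_image, Prod.mk.injEq,
    Set.mem_singleton_iff]
  constructor
  · rintro ⟨⟨z, hz, rfl, rfl⟩, rfl⟩
    exact ⟨rfl, rfl⟩
  · rintro ⟨rfl, rfl⟩
    exact ⟨⟨_, hx, rfl, rfl⟩, rfl⟩

theorem insertionPositions_at_of_notMem (h : IsLatchSeq S hook q n)
    {x : ℕ × V} (hx : x ∉ freeNodes S hook (fun _ => True) q n) :
    {p ∈ insertionPositions S hook 1 q n | p.1 = x} = ∅ := by
  ext ⟨y, c⟩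
  simp only [insertionPositions_eq h, Set.mem_ofPred_eq, Set.mem_image, Prod.mk.injEq,
    Set.mem_empty_iff_false, iff_false]
  rintro ⟨⟨z, hz, rfl, rfl⟩, rfl⟩
  exact hx hz

theorem nodeCount_zero (h : IsLatchSeq S hook q n) (δ : ℕ) :
    nodeCount S hook q n δ 0 = (freeNodes S hook (fun v => degree S v = δ) q n).ncard := by
  rw [nodeCount, vertexSet_network h]
  congr 1
  ext x
  simp only [freeNodes, Set.mem_ofPred_eq]
  refine and_congr_right fun hx => ?_
  rw [originalDegree_eq hx h, latchCount_eq_zero_iff h]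

theorem nodeCount_one (h : IsLatchSeq S hook q n) (δ : ℕ) :
    nodeCount S hook q n δ 1 = latchTally (fun v => degree S v = δ) q n := by
  rw [← ncard_latched _ h, nodeCount, vertexSet_network h]
  congr 1
  ext x
  simp only [Set.mem_ofPred_eq]
  refine and_congr_right fun hx => ?_
  rw [originalDegree_eq hx h, latchCount_eq_one_iff h]

open Classical in
theorem latchTally_succ (p : V → Prop) (q : ℕ → ℕ × V) (n : ℕ) :
    latchTally p q (n + 1) = latchTally p q n + if p (q n).2 then 1 else 0 := by
  rw [latchTally, Finset.range_add_one, Finset.filter_insert]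
  split_ifs with h
  · rw [Finset.card_insert_of_notMem (by simp), latchTally]
  · rfl

theorem latchTally_congr (p : V → Prop) {q' : ℕ → ℕ × V} (h : ∀ t < n, q t = q' t) :
    latchTally p q n = latchTally p q' n := by
  classical
  rw [latchTally, latchTally]
  congr 1
  refine Finset.filter_congr fun t ht => ?_
  rw [h t (Finset.mem_range.1 ht)]

theorem latchTally_true (q : ℕ → ℕ × V) (n : ℕ) : latchTally (fun _ => True) q n = n := by
  simp [latchTally]

theorem ncard_ne_hook [Finite V] (hhook : hook ∈ V(S)) (p : V → Prop) [Decidable (p hook)] :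
    {v ∈ V(S) | v ≠ hook ∧ p v}.ncard + (if p hook then 1 else 0) =
      {v ∈ V(S) | p v}.ncard := by
  split_ifs with hp
  · have : {v ∈ V(S) | v ≠ hook ∧ p v} = {v ∈ V(S) | p v} \ {hook} := by
      ext v
      simp only [Set.mem_ofPred_eq, Set.mem_sdiff, Set.mem_singleton_iff]
      tauto
    rw [this]
    exact Set.ncard_sdiff_singleton_add_one (a := hook) ⟨hhook, hp⟩
  · rw [add_zero]
    congr 1
    ext v
    simp only [Set.mem_ofPred_eq]
    refine and_congr_right fun _ => ⟨fun h => h.2, fun h => ⟨?_, h⟩⟩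
    rintro rfl
    exact hp h

/-- Each step creates `τ - 1` free nodes and uses up one, whichever latch is chosen, so the urn
total is not random. -/
theorem ncard_freeNodes_true [Finite V] (hhook : hook ∈ V(S))
    (h : IsLatchSeq S hook q n) :
    ((freeNodes S hook (fun _ => True) q n).ncard : ℝ) =
      V(S).ncard + n * ((V(S).ncard : ℝ) - 2) := by
  have h1 := ncard_freeNodes_add_latchTally (fun _ => True) h
  have h2 := ncard_ne_hook hhook (fun _ => True)
  rw [latchTally_true] at h1
  simp only [and_true, if_true, Set.ofPred_mem_eq] at h1 h2
  have h1' : ((freeNodes S hook (fun _ => True) q n).ncard : ℝ) + n =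
      V(S).ncard + n * ({v ∈ V(S) | v ≠ hook}.ncard : ℝ) := by exact_mod_cast h1
  have h2' : ({v ∈ V(S) | v ≠ hook}.ncard : ℝ) + 1 = V(S).ncard := by exact_mod_cast h2
  linear_combination h1' + n * h2'

end Combinatorics

/-! ### Passing from the squares to all integers. -/

section Analysis

theorem abs_sub_le_of_abs_succ_sub_le {w : ℕ → ℝ} {B : ℝ} (hw : ∀ n, |w (n + 1) - w n| ≤ B)
    (m j : ℕ) : |w (m + j) - w m| ≤ j * B := by
  induction j with
  | zero => simp
  | succ j ih =>
    have h1 := abs_sub_le (w (m + j + 1)) (w (m + j)) (w m)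
    have h2 := hw (m + j)
    rw [← add_assoc]
    push_cast
    linarith

/-- A sequence with bounded increments is `o(n)` as soon as it is so along the squares. -/
theorem tendsto_div_of_tendsto_sq {w : ℕ → ℝ} {B : ℝ} (hw : ∀ n, |w (n + 1) - w n| ≤ B)
    (hsq : Tendsto (fun k : ℕ => w (k ^ 2) / (k : ℝ) ^ 2) atTop (𝓝 0)) :
    Tendsto (fun n : ℕ => w n / n) atTop (𝓝 0) := by
  have hB : 0 ≤ B := (abs_nonneg _).trans (hw 0)
  have hsqrt : Tendsto Nat.sqrt atTop atTop :=
    tendsto_atTop.2 fun b => eventually_atTop.2 ⟨b * b, fun n hn => Nat.le_sqrt.2 hn⟩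
  have hlim : Tendsto (fun k : ℕ => |w (k ^ 2) / (k : ℝ) ^ 2| + 2 * B / (k : ℝ)) atTop (𝓝 0) := by
    simpa using hsq.abs.add (tendsto_const_div_atTop_nhds_zero_nat (2 * B))
  refine squeeze_zero_norm' ?_ (hlim.comp hsqrt)
  filter_upwards [eventually_ge_atTop 1] with n hn
  simp only [Function.comp]
  -- Write `n = s² + j` with `s = ⌊√n⌋`; then `j ≤ 2s`, so `w` moves by at most `2sB` from `s²` to
  -- `n`, which is negligible against `s²`.
  have hs1 : 1 ≤ Nat.sqrt n := Nat.le_sqrt.2 (by omega)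
  have hle : Nat.sqrt n ^ 2 ≤ n := Nat.sqrt_le' n
  have hlt : n ≤ Nat.sqrt n * Nat.sqrt n + Nat.sqrt n + Nat.sqrt n := Nat.sqrt_le_add n
  generalize Nat.sqrt n = s at *
  obtain ⟨j, rfl⟩ := Nat.exists_eq_add_of_le hle
  have hj : j ≤ 2 * s := by nlinarith
  have h1 := abs_sub_le_of_abs_succ_sub_le hw (s ^ 2) j
  have hsR : (0 : ℝ) < s := by exact_mod_cast hs1
  have hjR : (j : ℝ) ≤ 2 * s := by exact_mod_cast hj
  have h2 : |w (s ^ 2 + j)| ≤ |w (s ^ 2)| + 2 * s * B := by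
    have h3 := abs_sub_abs_le_abs_sub (w (s ^ 2 + j)) (w (s ^ 2))
    have h4 := mul_le_mul_of_nonneg_right hjR hB
    linarith
  have hden : (s : ℝ) ^ 2 ≤ ((s ^ 2 + j : ℕ) : ℝ) := by
    push_cast
    linarith [Nat.cast_nonneg (α := ℝ) j]
  rw [Real.norm_eq_abs, abs_div, Nat.abs_cast]
  calc |w (s ^ 2 + j)| / ((s ^ 2 + j : ℕ) : ℝ)
      ≤ (|w (s ^ 2)| + 2 * s * B) / (s : ℝ) ^ 2 := by gcongr
    _ = |w (s ^ 2) / (s : ℝ) ^ 2| + 2 * B / s := by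
      rw [abs_div, abs_of_nonneg (sq_nonneg (s : ℝ))]
      field_simp

end Analysis

/-! ### Almost sure convergence from second moments. -/

section SecondMoment

variable {Ω : Type*} [MeasurableSpace Ω] {P : Measure Ω}

/-- Random variables with bounded increments and linearly bounded second moments are almost surely
`o(n)`. -/
theorem ae_tendsto_div_of_lintegral_sq_le {W : ℕ → Ω → ℝ} (hmeas : ∀ n, Measurable (W n)) {B c : ℝ}
    (hc : 0 ≤ c) (hW : ∀ n ω, |W (n + 1) ω - W n ω| ≤ B)
    (hsq : ∀ n, ∫⁻ ω, ENNReal.ofReal (W n ω ^ 2) ∂P ≤ ENNReal.ofReal (c + n)) :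
    ∀ᵐ ω ∂P, Tendsto (fun n : ℕ => W n ω / n) atTop (𝓝 0) := by
  -- The `k`-th expectation is at most `(c + 1) / k²`, so the random series has finite expectation,
  -- converges almost surely, and its terms tend to `0`.
  have hint : ∫⁻ ω, ∑' k : ℕ, ENNReal.ofReal ((W (k ^ 2) ω / (k : ℝ) ^ 2) ^ 2) ∂P ≠ ⊤ := by
    rw [lintegral_tsum fun k => by fun_prop]
    have hsum : Summable fun k : ℕ => (c + 1) * (1 / (k : ℝ) ^ 2) :=
      (Real.summable_one_div_nat_pow.2 one_lt_two).mul_left _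
    refine ne_top_of_le_ne_top hsum.tsum_ofReal_ne_top (ENNReal.tsum_le_tsum fun k => ?_)
    rcases Nat.eq_zero_or_pos k with rfl | hk
    · simp
    have hkR : (1 : ℝ) ≤ k := by exact_mod_cast hk
    have hfun : ∀ ω, ENNReal.ofReal ((W (k ^ 2) ω / (k : ℝ) ^ 2) ^ 2) =
        ENNReal.ofReal (1 / (k : ℝ) ^ 4) * ENNReal.ofReal (W (k ^ 2) ω ^ 2) := fun ω => by
      rw [← ENNReal.ofReal_mul (by positivity)]
      congr 1
      field_simp
    simp_rw [hfun]
    rw [lintegral_const_mul _ (by fun_prop)]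
    calc _ ≤ ENNReal.ofReal (1 / (k : ℝ) ^ 4) * ENNReal.ofReal (c + (k ^ 2 : ℕ)) := by
          gcongr
          exact hsq _
      _ = ENNReal.ofReal (1 / (k : ℝ) ^ 4 * (c + (k ^ 2 : ℕ))) :=
          (ENNReal.ofReal_mul (by positivity)).symm
      _ ≤ _ := by
          apply ENNReal.ofReal_le_ofReal
          have h1 : c + ((k ^ 2 : ℕ) : ℝ) ≤ (c + 1) * (k : ℝ) ^ 2 := by
            push_cast
            nlinarith [one_le_pow₀ hkR (n := 2)]
          calc _ ≤ 1 / (k : ℝ) ^ 4 * ((c + 1) * (k : ℝ) ^ 2) := by gcongr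
            _ = _ := by field_simp
  have hae := ae_lt_top (by fun_prop) hint
  filter_upwards [hae] with ω hω
  refine tendsto_div_of_tendsto_sq (fun n => hW n ω) ?_
  have h0 := ENNReal.tendsto_cofinite_zero_of_tsum_ne_top hω.ne
  rw [Nat.cofinite_eq_atTop] at h0
  have h1 := (ENNReal.tendsto_toReal ENNReal.zero_ne_top).comp h0
  have h2 : Tendsto (fun k : ℕ => (W (k ^ 2) ω / (k : ℝ) ^ 2) ^ 2) atTop (𝓝 0) := by
    simpa [Function.comp_def, ENNReal.toReal_ofReal, sq_nonneg] using h1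
  have h3 := h2.sqrt
  simp only [Real.sqrt_sq_eq_abs, Real.sqrt_zero] at h3
  exact (tendsto_zero_iff_abs_tendsto_zero _).2 h3

end SecondMoment

/-! ### Conditioning on finite histories. -/

section History

variable {X Ω : Type*} {L : ℕ → Ω → X}

/-- The event that the first `n` values of `L` are those of `q`. -/
def history (L : ℕ → Ω → X) (q : ℕ → X) (n : ℕ) : Set Ω :=
  {ω | ∀ t < n, L t ω = q t}

theorem history_succ (L : ℕ → Ω → X) (q : ℕ → X) (n : ℕ) :
    history L q (n + 1) = history L q n ∩ {ω | L n ω = q n} := by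
  ext ω
  simp only [history, Set.mem_ofPred_eq, Set.mem_inter_iff, Nat.lt_succ_iff_lt_or_eq]
  constructor
  · exact fun h => ⟨fun t ht => h t (Or.inl ht), h n (Or.inr rfl)⟩
  · rintro ⟨h1, h2⟩ t (ht | rfl)
    exacts [h1 t ht, h2]

/-- An infinite continuation of a finite sequence. -/
def extend [Nonempty X] {n : ℕ} (h : Fin n → X) (t : ℕ) : X :=
  if ht : t < n then h ⟨t, ht⟩ else Classical.arbitrary X

theorem mem_history_extend [Nonempty X] {n : ℕ} {h : Fin n → X} {ω : Ω} :
    ω ∈ history L (extend h) n ↔ (fun t : Fin n => L t ω) = h := by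
  rw [funext_iff, Fin.forall_iff]
  refine forall₂_congr fun t ht => ?_
  simp [extend, ht]

theorem iUnion_history [Nonempty X] (L : ℕ → Ω → X) (n : ℕ) :
    ⋃ h : Fin n → X, history L (extend h) n = Set.univ :=
  Set.eq_univ_of_forall fun _ => Set.mem_iUnion.2 ⟨_, mem_history_extend.2 rfl⟩

theorem pairwise_disjoint_history [Nonempty X] (L : ℕ → Ω → X) (n : ℕ) :
    Pairwise (Function.onFun Disjoint fun h : Fin n → X => history L (extend h) n) := by
  intro h h' hne
  refine Set.disjoint_left.2 fun ω h1 h2 => hne ?_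
  rw [← mem_history_extend.1 h1, mem_history_extend.1 h2]

variable [MeasurableSpace Ω] {P : Measure Ω}

theorem measurableSet_history (hL : ∀ n x, MeasurableSet {ω | L n ω = x}) (q : ℕ → X) (n : ℕ) :
    MeasurableSet (history L q n) := by
  induction n with
  | zero => simp [history]
  | succ n ih =>
    rw [history_succ]
    exact ih.inter (hL n (q n))

theorem measurableSet_setOf_apply [Countable X] (hL : ∀ n x, MeasurableSet {ω | L n ω = x}) (n : ℕ)
    (p : X → Prop) : MeasurableSet {ω | p (L n ω)} := by
  have : {ω | p (L n ω)} = ⋃ x ∈ {x | p x}, {ω | L n ω = x} := by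
    ext ω
    simp
  rw [this]
  exact MeasurableSet.biUnion (Set.to_countable _) fun x _ => hL n x

/-- The countably many histories of length `n` partition the space, so this plays the role of the
tower property, and null histories may be ignored. -/
theorem lintegral_mono_of_history [Countable X] [Nonempty X]
    (hL : ∀ n x, MeasurableSet {ω | L n ω = x}) (n : ℕ) {f g : Ω → ENNReal}
    (hfg : ∀ q, P (history L q n) ≠ 0 →
      ∫⁻ ω in history L q n, f ω ∂P ≤ ∫⁻ ω in history L q n, g ω ∂P) :
    ∫⁻ ω, f ω ∂P ≤ ∫⁻ ω, g ω ∂P := by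
  rw [← setLIntegral_univ f, ← setLIntegral_univ g, ← iUnion_history L n,
    lintegral_iUnion (fun _ => measurableSet_history hL _ n) (pairwise_disjoint_history L n),
    lintegral_iUnion (fun _ => measurableSet_history hL _ n) (pairwise_disjoint_history L n)]
  refine ENNReal.tsum_le_tsum fun h => ?_
  by_cases h0 : P (history L (extend h) n) = 0
  · rw [setLIntegral_measure_zero _ _ h0]
    exact zero_le
  · exact hfg _ h0

/-- For each length there are only countably many null histories. Along almost every path the
uniform rule, which is silent on null histories, is therefore available at every step. -/
theorem ae_history_ne_zero [Countable X] [Nonempty X] (P : Measure Ω) (L : ℕ → Ω → X) :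
    ∀ᵐ ω ∂P, ∀ n, P (history L (fun t => L t ω) n) ≠ 0 := by
  refine ae_all_iff.2 fun n => ?_
  refine measure_mono_null (t := ⋃ h : {h : Fin n → X // P (history L (extend h) n) = 0},
    history L (extend h.1) n) ?_ (measure_iUnion_null fun h => h.2)
  intro ω hω
  have h0 : P (history L (fun t => L t ω) n) = 0 := by simpa using hω
  have h1 : history L (extend fun t : Fin n => L t ω) n = history L (fun t => L t ω) n := by
    ext ω'
    refine forall₂_congr fun t ht => ?_
    simp [extend, ht]
  exact Set.mem_iUnion.2 ⟨⟨fun t : Fin n => L t ω, h1 ▸ h0⟩, mem_history_extend.2 rfl⟩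

end History

/-! ### The drift of the urn and the law of large numbers for latches. -/

section UniformHooking

variable {V E : Type*} {S : Graph V E} {hook : V}
  {Ω : Type*} [MeasurableSpace Ω] {P : Measure Ω} [IsProbabilityMeasure P] {L : ℕ → Ω → ℕ × V}

/-- The number of free nodes at vertices with the property `p`, expressed through the latches and
centred at the value which is preserved by the mean drift. -/
def deviation (S : Graph V E) (hook : V) (p : V → Prop) (q : ℕ → ℕ × V) (n : ℕ) : ℝ :=
  {v ∈ V(S) | p v}.ncard + n * ({v ∈ V(S) | v ≠ hook ∧ p v}.ncard : ℝ) - latchTally p q n -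
    {v ∈ V(S) | v ≠ hook ∧ p v}.ncard * (V(S).ncard + n * ((V(S).ncard : ℝ) - 2)) /
      ((V(S).ncard : ℝ) - 1)

-- The drift of the centring cancels part of `B`: with `b = B / (τ - 1)`, one has `B - b(τ - 2) =
-- b`.
open Classical in
theorem deviation_succ (hsize : 2 ≤ V(S).ncard) (p : V → Prop) (q : ℕ → ℕ × V) (n : ℕ) :
    deviation S hook p q (n + 1) = deviation S hook p q n +
      {v ∈ V(S) | v ≠ hook ∧ p v}.ncard / ((V(S).ncard : ℝ) - 1) -
        if p (q n).2 then 1 else 0 := by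
  have : (V(S).ncard : ℝ) - 1 ≠ 0 := by
    have : (2 : ℝ) ≤ V(S).ncard := by exact_mod_cast hsize
    linarith
  simp only [deviation, latchTally_succ]
  push_cast
  field_simp
  ring

theorem deviation_congr (p : V → Prop) {q q' : ℕ → ℕ × V} {n : ℕ} (h : ∀ t < n, q t = q' t) :
    deviation S hook p q n = deviation S hook p q' n := by
  rw [deviation, deviation, latchTally_congr p h]

/-- A node that is absent or already used carries no position and so has conditional probability
zero; a history of positive probability never selects it. -/
theorem IsUniformHooking.isLatchSeq (hL : IsUniformHooking S hook 1 P L)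
    {q : ℕ → ℕ × V} {n : ℕ} (hq : P (history L q n) ≠ 0) : IsLatchSeq S hook q n := by
  induction n with
  | zero => exact fun t ht => absurd ht (Nat.not_lt_zero t)
  | succ n ih =>
    have hne : P (history L q n) ≠ 0 := by
      rw [history_succ] at hq
      exact fun h => hq (measure_mono_null Set.inter_subset_left h)
    have hlatch := ih hne
    have hfree : q n ∈ freeNodes S hook (fun _ => True) q n := by
      by_contra hcon
      have h1 := hL.uniform n q (q n) hne
      change ProbabilityTheory.cond P (history L q n) {ω | L n ω = q n} = _ at h1
      rw [insertionPositions_at_of_notMem hlatch hcon, Set.ncard_empty, Nat.cast_zero,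
        ENNReal.zero_div,
        ProbabilityTheory.cond_apply (measurableSet_history hL.measurable q n)] at h1
      rw [history_succ] at hq
      exact (mul_ne_zero (ENNReal.inv_ne_zero.2 (measure_ne_top P _)) hq) h1
    intro t ht
    rcases Nat.lt_succ_iff_lt_or_eq.1 ht with h | rfl
    · exact hlatch t h
    · exact ⟨hfree.1, hfree.2.2⟩

variable [Finite V]

theorem IsUniformHooking.cond_apply (hL : IsUniformHooking S hook 1 P L)
    {q : ℕ → ℕ × V} {n : ℕ} (hq : P (history L q n) ≠ 0) (p : V → Prop) :
    ProbabilityTheory.cond P (history L q n) {ω | p (L n ω).2} =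
      ((freeNodes S hook p q n).ncard : ENNReal) /
        ((freeNodes S hook (fun _ => True) q n).ncard : ENNReal) := by
  classical
  have hlatch := hL.isLatchSeq hq
  have hset : {ω | p (L n ω).2} = ⋃ x ∈ {x : ℕ × V | p x.2}, {ω | L n ω = x} := by
    ext ω
    simp
  have hfin : (freeNodes S hook p q n).Finite := (nodes_finite n).subset fun _ hx => hx.1
  have hterm : ∀ x, ProbabilityTheory.cond P (history L q n) {ω | L n ω = x} =
      if x ∈ freeNodes S hook (fun _ => True) q n then
        ((freeNodes S hook (fun _ => True) q n).ncard : ENNReal)⁻¹ else 0 := by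
    intro x
    have h1 := hL.uniform n q x hq
    rw [ncard_insertionPositions hlatch] at h1
    change ProbabilityTheory.cond P (history L q n) {ω | L n ω = x} = _ at h1
    rw [h1]
    split_ifs with hx
    · rw [ncard_insertionPositions_at_of_mem hlatch hx, Nat.cast_one, one_div]
    · rw [insertionPositions_at_of_notMem hlatch hx, Set.ncard_empty, Nat.cast_zero,
        ENNReal.zero_div]
  rw [hset, measure_biUnion (Set.to_countable _) _ fun x _ => hL.measurable n x]
  · simp_rw [hterm]
    rw [tsum_subtype {x : ℕ × V | p x.2} fun x =>
      if x ∈ freeNodes S hook (fun _ => True) q n then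
        ((freeNodes S hook (fun _ => True) q n).ncard : ENNReal)⁻¹ else 0]
    have : (Set.indicator {x : ℕ × V | p x.2} fun x =>
        if x ∈ freeNodes S hook (fun _ => True) q n then
          ((freeNodes S hook (fun _ => True) q n).ncard : ENNReal)⁻¹ else 0) =
        Set.indicator (freeNodes S hook p q n) fun _ =>
          ((freeNodes S hook (fun _ => True) q n).ncard : ENNReal)⁻¹ := by
      ext x
      by_cases h1 : p x.2 <;> simp [Set.indicator, freeNodes, h1]
    rw [this, ← tsum_subtype, ENNReal.tsum_set_const, ← hfin.cast_ncard_eq, div_eq_mul_inv]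
    simp
  · intro x _ y _ hxy
    refine Set.disjoint_left.2 fun ω h1 h2 => hxy ?_
    rw [← Set.mem_ofPred_eq.mp h1, ← Set.mem_ofPred_eq.mp h2]

theorem measurable_deviation (hL : ∀ n x, MeasurableSet {ω | L n ω = x}) (p : V → Prop) (n : ℕ) :
    Measurable fun ω => deviation S hook p (fun t => L t ω) n := by
  classical
  have : Measurable fun ω => (latchTally p (fun t => L t ω) n : ℝ) := by
    induction n with
    | zero => simp [latchTally]
    | succ n ih =>
      simp_rw [latchTally_succ]
      push_cast
      exact ih.add (Measurable.ite (measurableSet_setOf_apply hL n fun x => p x.2)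
        measurable_const measurable_const)
  unfold deviation
  fun_prop

/-- On one history `w` is constant and the next latch is a Bernoulli trial for `p`, so both
integrals are explicit. -/
theorem IsUniformHooking.lintegral_history_le (hL : IsUniformHooking S hook 1 P L)
    (hhook : hook ∈ V(S)) (hsize : 2 ≤ V(S).ncard) (p : V → Prop)
    {q : ℕ → ℕ × V} {n : ℕ} (hq : P (history L q n) ≠ 0) :
    ∫⁻ ω in history L q n, ENNReal.ofReal (deviation S hook p (fun t => L t ω) (n + 1) ^ 2) ∂P ≤
      ∫⁻ ω in history L q n,
        (ENNReal.ofReal (deviation S hook p (fun t => L t ω) n ^ 2) + 1) ∂P := by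
  classical
  have hlatch := hL.isLatchSeq hq
  have hτ : (2 : ℝ) ≤ V(S).ncard := by exact_mod_cast hsize
  set A := history L q n with hA
  have hAm : MeasurableSet A := measurableSet_history hL.measurable q n
  set D := {ω | p (L n ω).2} with hD
  have hDm : MeasurableSet D := measurableSet_setOf_apply hL.measurable n fun x => p x.2
  set w := deviation S hook p q n with hw
  have hdev : ∀ ω ∈ A, deviation S hook p (fun t => L t ω) n = w :=
    fun ω hω => deviation_congr p hω
  obtain ⟨b, hb⟩ : ∃ b : ℝ, b = {v ∈ V(S) | v ≠ hook ∧ p v}.ncard / ((V(S).ncard : ℝ) - 1) :=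
    ⟨_, rfl⟩
  obtain ⟨T, hT⟩ : ∃ T : ℝ, T = (freeNodes S hook (fun _ => True) q n).ncard := ⟨_, rfl⟩
  obtain ⟨y, hy⟩ : ∃ y : ℝ, y = (freeNodes S hook p q n).ncard := ⟨_, rfl⟩
  have hTeq : T = V(S).ncard + n * ((V(S).ncard : ℝ) - 2) := by
    rw [hT, ncard_freeNodes_true hhook hlatch]
  have hT1 : 1 ≤ T := by
    have : 0 ≤ (n : ℝ) * ((V(S).ncard : ℝ) - 2) := mul_nonneg n.cast_nonneg (by linarith)
    linarith
  have hwy : w = y - b * T := by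
    have h1 : ((freeNodes S hook p q n).ncard : ℝ) + latchTally p q n =
        {v ∈ V(S) | p v}.ncard + n * ({v ∈ V(S) | v ≠ hook ∧ p v}.ncard : ℝ) := by
      exact_mod_cast ncard_freeNodes_add_latchTally p hlatch
    rw [hw, deviation, ← h1, hb, hTeq, hy]
    ring
  have hyT : y ≤ T := by
    rw [hy, hT]
    have hsub : freeNodes S hook p q n ⊆ freeNodes S hook (fun _ => True) q n :=
      fun _ hx => ⟨hx.1, trivial, hx.2.2⟩
    exact_mod_cast Set.ncard_le_ncard hsub ((nodes_finite n).subset fun _ hx => hx.1)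
  have hy0 : 0 ≤ y := hy ▸ Nat.cast_nonneg _
  have hAD : P.real (A ∩ D) = P.real A * (y / T) := by
    have h1 := hL.cond_apply hq p
    rw [ProbabilityTheory.cond_apply hAm] at h1
    have h2 := congrArg ENNReal.toReal h1
    rw [ENNReal.toReal_mul, ENNReal.toReal_div, ENNReal.toReal_natCast, ENNReal.toReal_natCast,
      ENNReal.toReal_inv, ← hy, ← hT] at h2
    have h3 : (P A).toReal ≠ 0 := ENNReal.toReal_ne_zero.2 ⟨hq, measure_ne_top _ _⟩
    change (P (A ∩ D)).toReal = (P A).toReal * (y / T)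
    rw [← h2]
    field_simp
    rfl
  have hADc : P.real (A \ D) = P.real A * (1 - y / T) := by
    have := measureReal_inter_add_sdiff (μ := P) (s := A) hDm
    linarith
  have hleft : ∫⁻ ω in A, ENNReal.ofReal (deviation S hook p (fun t => L t ω) (n + 1) ^ 2) ∂P =
      ENNReal.ofReal ((w + b - 1) ^ 2 * P.real (A ∩ D) + (w + b) ^ 2 * P.real (A \ D)) := by
    rw [← lintegral_inter_add_sdiff _ A hDm,
      setLIntegral_congr_fun (g := fun _ => ENNReal.ofReal ((w + b - 1) ^ 2)) (hAm.inter hDm),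
      setLIntegral_congr_fun (g := fun _ => ENNReal.ofReal ((w + b) ^ 2))
        (MeasurableSet.diff hAm hDm),
      setLIntegral_const, setLIntegral_const, ENNReal.ofReal_add (by positivity) (by positivity),
      ENNReal.ofReal_mul (sq_nonneg _), ENNReal.ofReal_mul (sq_nonneg _), ofReal_measureReal,
      ofReal_measureReal]
    · rintro ω ⟨h1, h2⟩
      have h2' : ¬ p (L n ω).2 := h2
      simp only [deviation_succ hsize, hdev ω h1, ← hb, h2', if_false, sub_zero]
    · rintro ω ⟨h1, h2⟩
      have h2' : p (L n ω).2 := h2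
      simp only [deviation_succ hsize, hdev ω h1, ← hb, h2', if_true]
  have hright : ∫⁻ ω in A, (ENNReal.ofReal (deviation S hook p (fun t => L t ω) n ^ 2) + 1) ∂P =
      ENNReal.ofReal ((w ^ 2 + 1) * P.real A) := by
    rw [setLIntegral_congr_fun (g := fun _ => ENNReal.ofReal (w ^ 2 + 1)) hAm,
      setLIntegral_const, ENNReal.ofReal_mul (by positivity), ofReal_measureReal]
    intro ω hω
    simp only [hdev ω hω]
    rw [ENNReal.ofReal_add (sq_nonneg _) zero_le_one, ENNReal.ofReal_one]
  rw [hleft, hright, hAD, hADc]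
  apply ENNReal.ofReal_le_ofReal
  have hT0 : T ≠ 0 := by positivity
  -- The success probability exceeds `b` by `w / T`: the step pulls `w` back towards `0`.
  have hπ : y / T = w / T + b := by
    rw [hwy]
    field_simp
    ring
  have hπ0 : 0 ≤ y / T := by positivity
  have hπ1 : y / T ≤ 1 := div_le_one_of_le₀ hyT (by positivity)
  set π := y / T
  -- Since `T ≥ 1`, the factor `1 - 1/T` of the conditional mean lies in `[0, 1]`.
  have hu : (w - w / T) ^ 2 ≤ w ^ 2 := by
    have h1 : w - w / T = w * (1 - 1 / T) := by ring
    have h2 : 1 / T ≤ 1 := div_le_one_of_le₀ hT1 (by positivity)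
    have h3 : 0 ≤ 1 / T := by positivity
    rw [h1, mul_pow]
    exact mul_le_of_le_one_right (sq_nonneg _) (pow_le_one₀ (by linarith) (by linarith))
  have hb' : b = π - w / T := by linarith
  -- Second moment as squared mean plus Bernoulli variance.
  have key : (w + b - 1) ^ 2 * π + (w + b) ^ 2 * (1 - π) =
      (w - w / T) ^ 2 + π * (1 - π) := by
    rw [hb']
    ring
  have hle : (w + b - 1) ^ 2 * π + (w + b) ^ 2 * (1 - π) ≤ w ^ 2 + 1 := by
    rw [key]
    nlinarith
  calc _ = ((w + b - 1) ^ 2 * π + (w + b) ^ 2 * (1 - π)) * P.real A := by ring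
    _ ≤ _ := by gcongr

theorem IsUniformHooking.lintegral_deviation_sq_le (hL : IsUniformHooking S hook 1 P L)
    (hhook : hook ∈ V(S)) (hsize : 2 ≤ V(S).ncard) (p : V → Prop) (q₀ : ℕ → ℕ × V) (n : ℕ) :
    ∫⁻ ω, ENNReal.ofReal (deviation S hook p (fun t => L t ω) n ^ 2) ∂P ≤
      ENNReal.ofReal (deviation S hook p q₀ 0 ^ 2 + n) := by
  induction n with
  | zero =>
    have h0 : ∀ ω, deviation S hook p (fun t => L t ω) 0 = deviation S hook p q₀ 0 :=
      fun ω => deviation_congr p fun t ht => absurd ht (Nat.not_lt_zero t)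
    simp [h0]
  | succ n ih =>
    have : Nonempty (ℕ × V) := ⟨(0, hook)⟩
    calc _ ≤ ∫⁻ ω, (ENNReal.ofReal (deviation S hook p (fun t => L t ω) n ^ 2) + 1) ∂P :=
          lintegral_mono_of_history hL.measurable n fun q hq =>
            hL.lintegral_history_le hhook hsize p hq
      _ = ∫⁻ ω, ENNReal.ofReal (deviation S hook p (fun t => L t ω) n ^ 2) ∂P + 1 := by
          rw [lintegral_add_right _ measurable_const]
          simp
      _ ≤ ENNReal.ofReal (deviation S hook p q₀ 0 ^ 2 + n) + ENNReal.ofReal 1 := by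
          rw [ENNReal.ofReal_one]
          gcongr
      _ = _ := by
          rw [← ENNReal.ofReal_add (by positivity) zero_le_one]
          push_cast
          ring_nf

theorem IsUniformHooking.ae_tendsto_deviation_div (hL : IsUniformHooking S hook 1 P L)
    (hhook : hook ∈ V(S)) (hsize : 2 ≤ V(S).ncard) (p : V → Prop) :
    ∀ᵐ ω ∂P, Tendsto (fun n : ℕ => deviation S hook p (fun t => L t ω) n / n) atTop (𝓝 0) := by
  classical
  refine ae_tendsto_div_of_lintegral_sq_le (measurable_deviation hL.measurable p)
    (B := |{v ∈ V(S) | v ≠ hook ∧ p v}.ncard / ((V(S).ncard : ℝ) - 1)| + 1)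
    (sq_nonneg _) (fun n ω => ?_)
    -- Any sequence would do, since the deviation at age `0` involves no latch.
    (hL.lintegral_deviation_sq_le hhook hsize p fun _ => (0, hook))
  rw [deviation_succ hsize, add_sub_assoc, add_sub_cancel_left]
  refine (abs_sub _ _).trans ?_
  gcongr
  split_ifs <;> simp

theorem IsUniformHooking.ae_tendsto_latchTally_div (hL : IsUniformHooking S hook 1 P L)
    (hhook : hook ∈ V(S)) (hsize : 2 ≤ V(S).ncard) (p : V → Prop) :
    ∀ᵐ ω ∂P, Tendsto (fun n : ℕ => (latchTally p (fun t => L t ω) n : ℝ) / n) atTop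
      (𝓝 ({v ∈ V(S) | v ≠ hook ∧ p v}.ncard / ((V(S).ncard : ℝ) - 1))) := by
  filter_upwards [hL.ae_tendsto_deviation_div hhook hsize p] with ω hω
  have hτ : (V(S).ncard : ℝ) - 1 ≠ 0 := by
    have : (2 : ℝ) ≤ V(S).ncard := by exact_mod_cast hsize
    linarith
  obtain ⟨B, hB⟩ : ∃ B : ℝ, B = {v ∈ V(S) | v ≠ hook ∧ p v}.ncard := ⟨_, rfl⟩
  obtain ⟨A, hA⟩ : ∃ A : ℝ, A = {v ∈ V(S) | p v}.ncard := ⟨_, rfl⟩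
  -- Solving the definition of `deviation` for the tally gives `b + (A - bτ)/n - w/n` after division
  -- by `n`.
  have h1 := (tendsto_const_div_atTop_nhds_zero_nat
    (A - B * V(S).ncard / ((V(S).ncard : ℝ) - 1))).sub hω
  have h2 := h1.const_add (B / ((V(S).ncard : ℝ) - 1))
  rw [sub_zero, add_zero] at h2
  rw [← hB]
  refine h2.congr' ?_
  filter_upwards [eventually_ge_atTop 1] with n hn
  have hn0 : (n : ℝ) ≠ 0 := by
    have : (1 : ℝ) ≤ n := by exact_mod_cast hn
    linarith
  rw [deviation, ← hB, ← hA]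
  field_simp
  ring

end UniformHooking

end HookingNetwork

end

/-! ### Assembling the limits over all original degrees. -/

theorem corollary1 {V E : Type*} [Finite V] [Finite E]
    (S : Graph V E) (hconn : HookingNetwork.Connected S) (hsize : 2 ≤ V(S).ncard)
    (hook : V) (hhook : hook ∈ V(S))
    (k : ℕ) (d : Fin k → ℕ) (hd : StrictMono d)
    (hdeg : Set.range d = HookingNetwork.degree S '' V(S))
    (i : Fin k) (hi : d i = HookingNetwork.degree S hook)
    (hnondeg : HookingNetwork.Nondegenerate 1
      (fun j : Fin k => HookingNetwork.seedCount S (d j)) i)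
    {Ω : Type*} [MeasurableSpace Ω] (P : Measure Ω) [IsProbabilityMeasure P]
    (L : ℕ → Ω → ℕ × V) (hL : HookingNetwork.IsUniformHooking S hook 1 P L) :
    ∀ᵐ ω ∂P, Tendsto
      (fun n : ℕ => fun c : Fin 2 × Fin k =>
        (1 / (n : ℝ)) *
          (HookingNetwork.nodeCount S hook (fun t => L t ω) n (d c.2) (c.1 : ℕ) : ℝ))
      atTop
      (𝓝 (fun c : Fin 2 × Fin k =>
        (1 / ((V(S).ncard : ℝ) - 1)) *
          ((if c.1 = 0 then (V(S).ncard : ℝ) - 2 else 1) *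
            ((HookingNetwork.seedCount S (d c.2) : ℝ) - if c.2 = i then 1 else 0)))) := by
  classical
  have : Nonempty (ℕ × V) := ⟨(0, hook)⟩
  have hτ : (V(S).ncard : ℝ) - 1 ≠ 0 := by
    have : (2 : ℝ) ≤ V(S).ncard := by exact_mod_cast hsize
    linarith
  filter_upwards [HookingNetwork.ae_history_ne_zero P L,
    ae_all_iff.2 fun j : Fin k => hL.ae_tendsto_latchTally_div hhook hsize
      fun v => HookingNetwork.degree S v = d j] with ω hω hlim
  have hlatch : ∀ n, HookingNetwork.IsLatchSeq S hook (fun t => L t ω) n :=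
    fun n => hL.isLatchSeq (hω n)
  refine tendsto_pi_nhds.2 fun ⟨s, j⟩ => ?_
  have hB : ({v ∈ V(S) | v ≠ hook ∧ HookingNetwork.degree S v = d j}.ncard : ℝ) =
      (HookingNetwork.seedCount S (d j) : ℝ) - if j = i then 1 else 0 := by
    have h1 := HookingNetwork.ncard_ne_hook hhook fun v => HookingNetwork.degree S v = d j
    -- The degrees `d j` are distinct, so leaving out the hook lowers only the `i`-th count.
    have h2 : HookingNetwork.degree S hook = d j ↔ j = i := by
      rw [← hi, hd.injective.eq_iff, eq_comm]
    simp only [h2] at h1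
    rw [HookingNetwork.seedCount, ← h1]
    push_cast
    ring
  have hlimj := hlim j
  simp only [← hB]
  fin_cases s
  -- Free nodes: by the conservation law the limit is `B - B/(τ - 1) = B(τ - 2)/(τ - 1)`.
  · have h0 := tendsto_const_div_atTop_nhds_zero_nat (HookingNetwork.seedCount S (d j) : ℝ)
    have h1 := (h0.add_const ({v ∈ V(S) | v ≠ hook ∧
      HookingNetwork.degree S v = d j}.ncard : ℝ)).sub hlimj
    convert h1.congr' ?_ using 2
    · simp only [Fin.zero_eta, if_true]
      field_simp
      ring
    · filter_upwards [eventually_ge_atTop 1] with n hn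
      have hn0 : (n : ℝ) ≠ 0 := by
        have : (1 : ℝ) ≤ n := by exact_mod_cast hn
        linarith
      have h2 : ((HookingNetwork.freeNodes S hook (fun v => HookingNetwork.degree S v = d j)
          (fun t => L t ω) n).ncard : ℝ) + HookingNetwork.latchTally
            (fun v => HookingNetwork.degree S v = d j) (fun t => L t ω) n =
          HookingNetwork.seedCount S (d j) + n * ({v ∈ V(S) | v ≠ hook ∧
            HookingNetwork.degree S v = d j}.ncard : ℝ) := by
        exact_mod_cast HookingNetwork.ncard_freeNodes_add_latchTally _ (hlatch n)
      simp only [HookingNetwork.nodeCount_zero (hlatch n)]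
      field_simp
      linear_combination -h2
  · convert hlimj using 2 with n
    · simp only [HookingNetwork.nodeCount_one (hlatch n)]
      ring
    · simp only [Fin.mk_one, one_ne_zero, if_false]
      ring
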